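/- Let $d\ge 1$ and let $c,v_0\in\mathbb{R}^d$ have all coordinates positive. Put $f(x):=e^{c^\top x}-1$ and, for $u>0$, $Q_u:=v_0+u[0,1]^d$. For a concave function $\mu$ on $Q_u$ with $\mu\ge f$ on $Q_u$, define two sets of points $(x,y,z)\in\mathbb{R}^d\times\mathbb{R}\times\mathbb{R}$. The naive relaxation is $$P^0(f,Q_u,\mu):=\{(x,y,z):\ \tilde\mu(x,z)\ge y\ge f(x),\ x\in zQ_u,\ 0\le z\le 1\},$$ and the perspective relaxation $P(f,Q_u,\mu)$ is the closed convex hull of $$\{(x,y,z):\ \tilde\mu(x,z)\ge y\ge zf(x/z),\ x\in zQ_u,\ 0<z\le 1\}.$$ Here $\tilde\mu(x,z):=z\mu(x/z)$ for $z>0$, and $\tilde\mu(0,0):=0$. Let $\mathrm{vol}$ be Lebesgue measure on $\mathbb{R}^{d+2}$, and let $\Delta_\mu(u):=\mathrm{vol}(P^0(f,Q_u,\mu))-\mathrm{vol}(P(f,Q_u,\mu))$ be the cut-off amount. Consider two upper bounds: the concave envelope $\mathrm{conc}(f)$, i.e. the smallest concave upper bound of $f$ on $Q_u$, and the constant $$F:=\max_{x\in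 Q_u}f(x)=f(v_0+u\mathbf 1)=e^{c^\top v_0}e^{u\,c^\top\mathbf 1}-1 .$$ For every $u>0$ they have the same cut-off amount, $\Delta_{\mathrm{conc}(f)}(u)=\Delta_F(u)=:\Delta(P^0,P)$, and $$\lim_{u\to\infty}u^d\cdot\frac{\Delta(P^0,P)}{\mathrm{vol}(P^0(f,Q_u,\mathrm{conc}(f)))}=\lim_{u\to\infty}u^d\cdot\frac{(d+1)\,\Delta(P^0,P)}{\mathrm{vol}(P^0(f,Q_u,F))}=\frac{d+1}{\prod_{j=1}^d c_j}.$$ In particular, for both upper bounds the cut-off ratio $\Delta(P^0,P)/\mathrm{vol}(P^0)$ tends to $0$ as $u\to\infty$, so the naive relaxation is asymptotically as tight as the perspective relaxation. -/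

import Mathlib

open scoped Pointwise

noncomputable section

namespace BoxRelax

/-- The box `Q_u = v₀ + u [0,1]^d`. -/
def box {d : ℕ} (v₀ : Fin d → ℝ) (u : ℝ) : Set (Fin d → ℝ) :=
  (fun t => v₀ + u • t) '' Set.Icc 0 1

/-- The function `f(x) = e^{cᵀx} - 1`. -/
def expFun {d : ℕ} (c : Fin d → ℝ) (x : Fin d → ℝ) : ℝ :=
  Real.exp (c ⬝ᵥ x) - 1

/-- The perspective function of `f`: `z f(x/z)` for `z > 0`, and `+∞` otherwise, except that
at the origin `(0, 0)` it takes the value `0` of its closure. -/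
def perspective {d : ℕ} (f : (Fin d → ℝ) → ℝ) (x : Fin d → ℝ) (z : ℝ) : EReal :=
  open Classical in
  if 0 < z then ((z * f (z⁻¹ • x) : ℝ) : EReal)
  else if x = 0 ∧ z = 0 then 0
  else ⊤

/-- The upper bound `μ̃`: the negative of the perspective function of `-μ`. -/
def upperPerspective {d : ℕ} (μ : (Fin d → ℝ) → ℝ) (x : Fin d → ℝ) (z : ℝ) : EReal :=
  -perspective (fun w => -μ w) x z

/-- The perspective relaxation `P(f, Q, μ)`, a closed convex hull in the space of
triples `(x, y, z)`. -/
def perspRelaxation {d : ℕ} (f : (Fin d → ℝ) → ℝ) (Q : Set (Fin d → ℝ))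
    (μ : (Fin d → ℝ) → ℝ) : Set ((Fin d → ℝ) × ℝ × ℝ) :=
  closedConvexHull ℝ
    {p | perspective f p.1 p.2.2 ≤ (p.2.1 : EReal) ∧
      (p.2.1 : EReal) ≤ upperPerspective μ p.1 p.2.2 ∧
      p.1 ∈ p.2.2 • Q ∧ 0 < p.2.2 ∧ p.2.2 ≤ 1}

/-- The naive relaxation `P⁰(f, Q, μ)`. -/
def naiveRelaxation {d : ℕ} (f : (Fin d → ℝ) → ℝ) (Q : Set (Fin d → ℝ))
    (μ : (Fin d → ℝ) → ℝ) : Set ((Fin d → ℝ) × ℝ × ℝ) :=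
  {p | f p.1 ≤ p.2.1 ∧ (p.2.1 : EReal) ≤ upperPerspective μ p.1 p.2.2 ∧
    p.1 ∈ p.2.2 • Q ∧ 0 ≤ p.2.2 ∧ p.2.2 ≤ 1}

/-- Lebesgue measure in `ℝ^d × ℝ × ℝ`, as a real number. -/
def vol {d : ℕ} (P : Set ((Fin d → ℝ) × ℝ × ℝ)) : ℝ :=
  (MeasureTheory.volume P).toReal

/-- The cut-off amount `Δ(P⁰, P) = vol(P⁰) - vol(P)`. -/
def cutOff {d : ℕ} (f : (Fin d → ℝ) → ℝ) (Q : Set (Fin d → ℝ)) (μ : (Fin d → ℝ) → ℝ) : ℝ :=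
  vol (naiveRelaxation f Q μ) - vol (perspRelaxation f Q μ)

/-- The cut-off ratio `Δ(P⁰, P) / vol(P⁰)`. -/
def cutOffRatio {d : ℕ} (f : (Fin d → ℝ) → ℝ) (Q : Set (Fin d → ℝ))
    (μ : (Fin d → ℝ) → ℝ) : ℝ :=
  cutOff f Q μ / vol (naiveRelaxation f Q μ)

/-- The maximum of `f` over `Q`, when it is attained. -/
def maxOn {d : ℕ} (f : (Fin d → ℝ) → ℝ) (Q : Set (Fin d → ℝ)) : ℝ :=
  sSup (f '' Q)

/-- `g` is a concave upper bound of `f` on `Q`. -/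
def IsConcaveUpperBound {d : ℕ} (f : (Fin d → ℝ) → ℝ) (Q : Set (Fin d → ℝ))
    (g : (Fin d → ℝ) → ℝ) : Prop :=
  ConcaveOn ℝ Q g ∧ ∀ x ∈ Q, f x ≤ g x

/-- The concave envelope of `f` on `Q`: the smallest concave upper bound, as the pointwise
infimum of all concave upper bounds. Only its values on `Q` are meaningful. -/
def concEnv {d : ℕ} (f : (Fin d → ℝ) → ℝ) (Q : Set (Fin d → ℝ)) (x : Fin d → ℝ) : ℝ :=
  sInf {y | ∃ g, IsConcaveUpperBound f Q g ∧ y = g x}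

theorem concEnv_le {d : ℕ} {f g : (Fin d → ℝ) → ℝ} {Q : Set (Fin d → ℝ)}
    (hg : IsConcaveUpperBound f Q g) {x : Fin d → ℝ} (hx : x ∈ Q) : concEnv f Q x ≤ g x := by
  refine csInf_le ⟨f x, ?_⟩ ⟨g, hg, rfl⟩
  rintro _ ⟨h, hh, rfl⟩
  exact hh.2 x hx

/-- On a convex set on which `f` is bounded above, the concave envelope is itself a concave
upper bound, hence by `concEnv_le` the smallest one. -/
theorem concEnv_isConcaveUpperBound {d : ℕ} {f : (Fin d → ℝ) → ℝ} {Q : Set (Fin d → ℝ)}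
    (hQ : Convex ℝ Q) (hf : BddAbove (f '' Q)) : IsConcaveUpperBound f Q (concEnv f Q) := by
  obtain ⟨M, hM⟩ := hf
  have hMb : IsConcaveUpperBound f Q (fun _ => M) :=
    ⟨concaveOn_const M hQ, fun x hx => hM ⟨x, hx, rfl⟩⟩
  refine ⟨⟨hQ, fun x hx y hy a b ha hb hab => ?_⟩, fun x hx => ?_⟩
  · refine le_csInf ⟨M, _, hMb, rfl⟩ ?_
    rintro _ ⟨g, hg, rfl⟩
    refine le_trans ?_ (hg.1.2 hx hy ha hb hab)
    exact add_le_add (mul_le_mul_of_nonneg_left (concEnv_le hg hx) ha)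
      (mul_le_mul_of_nonneg_left (concEnv_le hg hy) hb)
  · refine le_csInf ⟨M, _, hMb, rfl⟩ ?_
    rintro _ ⟨g, hg, rfl⟩
    exact hg.2 x hx

end BoxRelax

end

/-!
Up to null sets each relaxation is a stack of dilates `z • K z`, `0 < z ≤ 1`, where `K z` is the
region between two graphs over `Q`: from `f` up to `μ` for the perspective relaxation, from
`z⁻¹ f(z ·)` up to `μ` for the naive one. Integrating over `z`, the bound `μ` contributes the same
term `(∫ μ) / (d + 2)` to both volumes, so the cut-off amount
`(∫ f) / (d + 2) - ∫₀¹ z^d ∫ f(z w) dw dz` does not depend on `μ`.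

On the box `Q_u`, let `e^k` be the value of `e^{cᵀx}` at the far corner. The first term of the
cut-off amount is asymptotic to `e^k / ((d + 2) ∏ c_j)`, while the second is `O(e^k / k + u^d)`.
The volume of the naive relaxation is asymptotic to `(∫ μ) / (d + 2)`. Up to lower-order terms the
concave envelope at `v₀ + u t` is `e^k min_j t_j`, and `min_j t_j` has mean `1 / (d + 1)` over the
unit cube: this is the factor `d + 1` between the two bounds.
-/

namespace BoxRelax

open MeasureTheory Set Filter Topology

section Slices

variable {α β : Type*} [MeasurableSpace α] [MeasurableSpace β] {μ : Measure α} {ν : Measure β}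

theorem measure_prod_eq_lintegral_of_nullMeasurableSet [SFinite ν] {s : Set (α × β)}
    (hs : NullMeasurableSet s (μ.prod ν)) : μ.prod ν s = ∫⁻ x, ν (Prod.mk x ⁻¹' s) ∂μ := by
  obtain ⟨t, -, ht, hts⟩ := hs.exists_measurable_subset_ae_eq
  rw [← measure_congr hts, Measure.prod_apply ht]
  refine lintegral_congr_ae ?_
  filter_upwards [Measure.ae_ae_of_ae_prod hts] with x hx
  exact measure_congr hx

/-- The points over `s` between the graphs of `f` and `g`, both graphs included: the closed
counterpart of `regionBetween`. -/
def closedRegionBetween (f g : α → ℝ) (s : Set α) : Set (α × ℝ) :=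
  {p | p.1 ∈ s ∧ p.2 ∈ Icc (f p.1) (g p.1)}

theorem nullMeasurableSet_closedRegionBetween {f g : α → ℝ} {s : Set α} (hs : MeasurableSet s)
    (hf : AEMeasurable f (μ.restrict s)) (hg : AEMeasurable g (μ.restrict s)) :
    NullMeasurableSet (closedRegionBetween f g s) (μ.prod volume) := by
  have h := nullMeasurableSet_region_between_cc μ ((aemeasurable_indicator_iff hs).2 hf)
    ((aemeasurable_indicator_iff hs).2 hg) hs.nullMeasurableSet
  convert h using 1
  ext ⟨x, y⟩
  exact and_congr_right fun hx => by simp only [indicator_of_mem hx]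

theorem volume_closedRegionBetween {f g : α → ℝ} {s : Set α} (hs : MeasurableSet s)
    (hf : IntegrableOn f s μ) (hg : IntegrableOn g s μ) (hfg : ∀ x ∈ s, f x ≤ g x) :
    μ.prod volume (closedRegionBetween f g s) =
      ENNReal.ofReal (∫ x in s, g x ∂μ - ∫ x in s, f x ∂μ) := by
  have hslice (x : α) : volume (Prod.mk x ⁻¹' closedRegionBetween f g s) =
      s.indicator (fun x => ENNReal.ofReal (g x - f x)) x := by
    by_cases hx : x ∈ s
    · rw [indicator_of_mem hx, ← Real.volume_Icc]
      congr 1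
      ext y
      exact and_iff_right hx
    · rw [indicator_of_notMem hx]
      exact (congrArg volume (eq_empty_of_forall_notMem fun y h => hx h.1)).trans measure_empty
  rw [measure_prod_eq_lintegral_of_nullMeasurableSet
      (nullMeasurableSet_closedRegionBetween hs hf.aemeasurable hg.aemeasurable),
    lintegral_congr hslice, lintegral_indicator hs, ← integral_sub hg hf]
  refine (ofReal_integral_eq_lintegral_ofReal (hg.sub hf) ?_).symm
  exact (ae_restrict_iff' hs).2 (ae_of_all _ fun x hx => sub_nonneg.2 (hfg x hx))

theorem convex_closedRegionBetween {E : Type*} [AddCommGroup E] [Module ℝ E] {f g : E → ℝ}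
    {s : Set E} (hf : ConvexOn ℝ s f) (hg : ConcaveOn ℝ s g) :
    Convex ℝ (closedRegionBetween f g s) := by
  have heq : closedRegionBetween f g s =
      {p | p.1 ∈ s ∧ f p.1 ≤ p.2} ∩ {p | p.1 ∈ s ∧ p.2 ≤ g p.1} := by
    ext p
    exact and_and_left
  rw [heq]
  exact hf.convex_epigraph.inter hg.convex_hypograph

end Slices

/-- The points `(x, y, z)` with `0 < z ≤ 1` and `(x, y) ∈ z • K z`. A constant `K` gives the
truncated cone over `K`; both relaxations are of this form up to null sets. -/
def dilationStack {E : Type*} [SMul ℝ E] (K : ℝ → Set (E × ℝ)) : Set (E × ℝ × ℝ) :=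
  {p | p.2.2 ∈ Ioc 0 1 ∧ (p.1, p.2.1) ∈ p.2.2 • K p.2.2}

theorem convex_dilationStack_const {E : Type*} [AddCommGroup E] [Module ℝ E]
    {K : Set (E × ℝ)} (hK : Convex ℝ K) : Convex ℝ (dilationStack fun _ => K) := by
  rintro ⟨x, y, z⟩ ⟨⟨hz₀, hz₁⟩, k, hk, hkx⟩ ⟨x', y', z'⟩ ⟨⟨hz₀', hz₁'⟩, k', hk', hkx'⟩ a b ha hb hab
  simp only [Prod.smul_mk, Prod.mk_add_mk, smul_eq_mul] at *
  have hw : 0 < a * z + b * z' := convex_Ioi (0 : ℝ) hz₀ hz₀' ha hb hab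
  refine ⟨⟨hw, convex_Iic (1 : ℝ) hz₁ hz₁' ha hb hab⟩,
    (a * z / (a * z + b * z')) • k + (b * z' / (a * z + b * z')) • k',
    hK hk hk' (by positivity) (by positivity) (by field_simp), ?_⟩
  have hcomb : (x, y) = z • k ∧ (x', y') = z' • k' := ⟨hkx.symm, hkx'.symm⟩
  change (a * z + b * z') • _ = _
  rw [smul_add, smul_smul, smul_smul, mul_div_cancel₀ _ hw.ne', mul_div_cancel₀ _ hw.ne',
    mul_smul, mul_smul, ← hcomb.1, ← hcomb.2]
  rfl

section Volume

variable {E : Type*} [NormedAddCommGroup E] [NormedSpace ℝ E] [FiniteDimensional ℝ E]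
  [MeasureSpace E] [BorelSpace E] [(volume : Measure E).IsAddHaarMeasure]

theorem volume_dilationStack {K : ℝ → Set (E × ℝ)} (hK : NullMeasurableSet (dilationStack K)) :
    volume (dilationStack K) =
      ∫⁻ z in Ioc 0 1, ENNReal.ofReal (z ^ (Module.finrank ℝ E + 1)) * volume (K z) := by
  have hpre : MeasurePreserving fun q : ℝ × E × ℝ => (q.2.1, q.2.2, q.1) :=
    volume_preserving_prodAssoc.comp Measure.measurePreserving_swap
  have : (volume : Measure (E × ℝ)).IsAddHaarMeasure :=
    Measure.prod.instIsAddHaarMeasure volume volume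
  rw [← hpre.measure_preimage hK, Measure.volume_eq_prod,
    measure_prod_eq_lintegral_of_nullMeasurableSet
      (hK.preimage hpre.quasiMeasurePreserving), ← lintegral_indicator measurableSet_Ioc]
  refine lintegral_congr fun z => ?_
  by_cases hz : z ∈ Ioc (0 : ℝ) 1
  · have hslice : Prod.mk z ⁻¹' ((fun q : ℝ × E × ℝ => (q.2.1, q.2.2, q.1)) ⁻¹' dilationStack K) =
        z • K z := by
      ext q
      exact and_iff_right hz
    rw [indicator_of_mem hz, hslice, Measure.addHaar_smul, Module.finrank_prod,
      Module.finrank_self, abs_of_pos (pow_pos hz.1 _)]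
  · rw [indicator_of_notMem hz]
    exact (congrArg volume (eq_empty_of_forall_notMem fun q h => hz h.1)).trans measure_empty

theorem volume_real_dilationStack_closedRegionBetween {ℓ : ℝ → E → ℝ} {μ : E → ℝ} {Q : Set E}
    (hQ : MeasurableSet Q)
    (hstack : NullMeasurableSet (dilationStack fun z => closedRegionBetween (ℓ z) μ Q))
    (hℓ : ∀ z ∈ Ioc (0 : ℝ) 1, IntegrableOn (ℓ z) Q) (hμ : IntegrableOn μ Q)
    (hℓμ : ∀ z ∈ Ioc (0 : ℝ) 1, ∀ w ∈ Q, ℓ z w ≤ μ w)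
    (hint : AEStronglyMeasurable (fun z => ∫ w in Q, ℓ z w) (volume.restrict (Ioc 0 1))) :
    volume.real (dilationStack fun z => closedRegionBetween (ℓ z) μ Q) =
      ∫ z in Ioc (0 : ℝ) 1, z ^ (Module.finrank ℝ E + 1) *
        ((∫ w in Q, μ w) - ∫ w in Q, ℓ z w) := by
  rw [integral_eq_lintegral_of_nonneg_ae, Measure.real, volume_dilationStack hstack]
  · congr 1
    refine setLIntegral_congr_fun measurableSet_Ioc fun z hz => ?_
    rw [ENNReal.ofReal_mul (pow_nonneg hz.1.le _), Measure.volume_eq_prod,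
      volume_closedRegionBetween hQ (hℓ z hz) hμ (hℓμ z hz)]
  · exact (ae_restrict_iff' measurableSet_Ioc).2 (ae_of_all _ fun z hz =>
      mul_nonneg (pow_nonneg hz.1.le _)
        (sub_nonneg.2 (setIntegral_mono_on (hℓ z hz) hμ hQ (hℓμ z hz))))
  · exact (continuous_pow _).aestronglyMeasurable.mul (aestronglyMeasurable_const.sub hint)

theorem isAddHaarMeasure_volume_prod_prod : (volume : Measure (E × ℝ × ℝ)).IsAddHaarMeasure :=
  have : (volume : Measure (ℝ × ℝ)).IsAddHaarMeasure :=
    Measure.prod.instIsAddHaarMeasure volume volume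
  Measure.prod.instIsAddHaarMeasure volume volume

theorem aestronglyMeasurable_of_concaveOn {g : E → ℝ} {s : Set E} (hg : ConcaveOn ℝ s g) :
    AEStronglyMeasurable g (volume.restrict s) := by
  rw [← Measure.restrict_congr_set
    (interior_ae_eq_of_null_frontier (hg.1.addHaar_frontier volume))]
  exact hg.continuousOn_interior.aestronglyMeasurable isOpen_interior.measurableSet

end Volume

theorem map_smul_le_of_convexOn {E : Type*} [AddCommGroup E] [Module ℝ E] {f : E → ℝ}
    (hf : ConvexOn ℝ univ f) (hf₀ : f 0 ≤ 0) {z : ℝ} (hz₀ : 0 ≤ z) (hz₁ : z ≤ 1) (w : E) :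
    f (z • w) ≤ z * f w := by
  have h := hf.2 (mem_univ w) (mem_univ 0) hz₀ (sub_nonneg.2 hz₁) (add_sub_cancel z 1)
  rw [smul_zero, add_zero, smul_eq_mul, smul_eq_mul] at h
  exact h.trans (add_le_of_nonpos_right (mul_nonpos_of_nonneg_of_nonpos (sub_nonneg.2 hz₁) hf₀))

section Relaxations

variable {d : ℕ} {f μ : (Fin d → ℝ) → ℝ} {Q : Set (Fin d → ℝ)}

theorem perspective_of_pos (f : (Fin d → ℝ) → ℝ) (x : Fin d → ℝ) {z : ℝ} (hz : 0 < z) :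
    perspective f x z = ((z * f (z⁻¹ • x) : ℝ) : EReal) :=
  if_pos hz

theorem upperPerspective_of_pos (μ : (Fin d → ℝ) → ℝ) (x : Fin d → ℝ) {z : ℝ} (hz : 0 < z) :
    upperPerspective μ x z = ((z * μ (z⁻¹ • x) : ℝ) : EReal) := by
  rw [upperPerspective, perspective_of_pos _ _ hz, mul_neg, EReal.coe_neg, neg_neg]

theorem mem_dilationStack_closedRegionBetween {ℓ : ℝ → (Fin d → ℝ) → ℝ}
    {p : (Fin d → ℝ) × ℝ × ℝ} :
    p ∈ (dilationStack fun z => closedRegionBetween (ℓ z) μ Q) ↔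
      p.2.2 ∈ Ioc (0 : ℝ) 1 ∧ p.1 ∈ p.2.2 • Q ∧
        p.2.2 * ℓ p.2.2 (p.2.2⁻¹ • p.1) ≤ p.2.1 ∧ p.2.1 ≤ p.2.2 * μ (p.2.2⁻¹ • p.1) := by
  refine and_congr_right fun hz => ?_
  rw [mem_smul_set_iff_inv_smul_mem₀ hz.1.ne', mem_smul_set_iff_inv_smul_mem₀ hz.1.ne',
    ← le_inv_mul_iff₀ hz.1, ← inv_mul_le_iff₀ hz.1]
  rfl

theorem perspRelaxation_eq_closedConvexHull_dilationStack (f μ : (Fin d → ℝ) → ℝ)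
    (Q : Set (Fin d → ℝ)) :
    perspRelaxation f Q μ =
      closedConvexHull ℝ (dilationStack fun _ => closedRegionBetween f μ Q) := by
  refine congrArg (fun s => (closedConvexHull ℝ s : Set _)) (Set.ext fun p => ?_)
  rw [mem_dilationStack_closedRegionBetween, mem_ofPred_eq]
  by_cases hz : 0 < p.2.2
  · rw [perspective_of_pos _ _ hz, upperPerspective_of_pos _ _ hz, EReal.coe_le_coe_iff,
      EReal.coe_le_coe_iff, mem_Ioc]
    tauto
  · exact iff_of_false (fun h => hz h.2.2.2.1) fun h => hz h.1.1

theorem vol_perspRelaxation_eq_volume_dilationStack (hf : ConvexOn ℝ Q f) (hμ : ConcaveOn ℝ Q μ) :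
    vol (perspRelaxation f Q μ) =
      volume.real (dilationStack fun _ => closedRegionBetween f μ Q) := by
  have := isAddHaarMeasure_volume_prod_prod (E := Fin d → ℝ)
  have hconv := convex_dilationStack_const (convex_closedRegionBetween hf hμ)
  rw [perspRelaxation_eq_closedConvexHull_dilationStack, closedConvexHull_eq_closure_convexHull,
    hconv.convexHull_eq]
  exact measureReal_congr (closure_ae_eq_of_null_frontier (hconv.addHaar_frontier volume))

theorem naiveRelaxation_inter_pos :
    naiveRelaxation f Q μ ∩ {p | 0 < p.2.2} =
      dilationStack fun z => closedRegionBetween (fun w => z⁻¹ * f (z • w)) μ Q := by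
  ext p
  rw [mem_dilationStack_closedRegionBetween]
  by_cases hz : 0 < p.2.2
  · rw [mul_inv_cancel_left₀ hz.ne', smul_inv_smul₀ hz.ne', ← EReal.coe_le_coe_iff (y := _ * _),
      ← upperPerspective_of_pos _ _ hz, mem_Ioc]
    exact ⟨fun ⟨⟨hf, hμ, hx, _, hz₁⟩, _⟩ => ⟨⟨hz, hz₁⟩, hx, hf, hμ⟩,
      fun ⟨⟨_, hz₁⟩, hx, hf, hμ⟩ => ⟨⟨hf, hμ, hx, hz.le, hz₁⟩, hz⟩⟩
  · exact iff_of_false (fun h => hz h.2) fun h => hz h.1.1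

/-- Convexity makes this set null-measurable even though `μ` need not be Borel. -/
theorem convex_naiveRelaxation_inter_pos (hf : ConvexOn ℝ univ f) (hμ : ConcaveOn ℝ Q μ) :
    Convex ℝ (naiveRelaxation f Q μ ∩ {p | 0 < p.2.2}) := by
  have heq : naiveRelaxation f Q μ ∩ {p | 0 < p.2.2} =
      (dilationStack fun _ => {p | p.1 ∈ Q ∧ p.2 ≤ μ p.1}) ∩
        {p | f p.1 ≤ p.2.1} := by
    rw [naiveRelaxation_inter_pos]
    ext p
    rw [mem_dilationStack_closedRegionBetween, mem_inter_iff, dilationStack, mem_ofPred_eq,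
      and_assoc]
    refine and_congr_right fun hz => ?_
    rw [mul_inv_cancel_left₀ hz.1.ne', smul_inv_smul₀ hz.1.ne',
      mem_smul_set_iff_inv_smul_mem₀ hz.1.ne', mem_smul_set_iff_inv_smul_mem₀ hz.1.ne',
      ← inv_mul_le_iff₀ hz.1]
    exact ⟨fun ⟨hx, hf, hμ⟩ => ⟨⟨hx, hμ⟩, hf⟩, fun ⟨⟨hx, hμ⟩, hf⟩ => ⟨hx, hf, hμ⟩⟩
  have hepi : Convex ℝ {p : (Fin d → ℝ) × ℝ × ℝ | f p.1 ≤ p.2.1} := by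
    simpa [preimage] using
      hf.convex_epigraph.linear_preimage (LinearMap.id.prodMap (LinearMap.fst ℝ ℝ ℝ))
  rw [heq]
  exact (convex_dilationStack_const hμ.convex_hypograph).inter hepi

theorem vol_naiveRelaxation_eq_volume_dilationStack :
    vol (naiveRelaxation f Q μ) = volume.real
      (dilationStack fun z => closedRegionBetween (fun w => z⁻¹ * f (z • w)) μ Q) := by
  have hheight : ∀ᵐ p : (Fin d → ℝ) × ℝ × ℝ, p.2.2 ≠ 0 :=
    (Measure.quasiMeasurePreserving_snd.comp Measure.quasiMeasurePreserving_snd).ae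
      (Measure.ae_ne volume 0)
  rw [← naiveRelaxation_inter_pos]
  refine measureReal_congr ?_
  filter_upwards [hheight] with p hz
  exact propext ⟨fun h => ⟨h, h.2.2.2.1.lt_of_ne' hz⟩, fun h => h.1⟩

/-- The integral of `(x, z) ↦ f x` over the cone `{(x, z) : x ∈ z • Q, 0 ≤ z ≤ 1}`, in the
coordinates `x = z • w`. -/
noncomputable def dilationIntegral (f : (Fin d → ℝ) → ℝ) (Q : Set (Fin d → ℝ)) : ℝ :=
  ∫ z in (0 : ℝ)..1, z ^ d * ∫ w in Q, f (z • w)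

theorem continuous_setIntegral_comp_smul (hf : Continuous f) (hQ : IsCompact Q) :
    Continuous fun z : ℝ => ∫ w in Q, f (z • w) :=
  continuous_parametric_integral_of_continuous (f := fun z w => f (z • w))
    (hf.comp continuous_smul) hQ

theorem vol_perspRelaxation (hQ : MeasurableSet Q) (hf : ConvexOn ℝ Q f)
    (hfint : IntegrableOn f Q) (hμ : IsConcaveUpperBound f Q μ) (hμint : IntegrableOn μ Q) :
    vol (perspRelaxation f Q μ) = ((∫ w in Q, μ w) - ∫ w in Q, f w) / (d + 2) := by
  have := isAddHaarMeasure_volume_prod_prod (E := Fin d → ℝ)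
  have hconv := convex_dilationStack_const (convex_closedRegionBetween hf hμ.1)
  rw [vol_perspRelaxation_eq_volume_dilationStack hf hμ.1,
    volume_real_dilationStack_closedRegionBetween hQ (hconv.nullMeasurableSet volume)
      (fun _ _ => hfint) hμint (fun _ _ => hμ.2) aestronglyMeasurable_const,
    ← intervalIntegral.integral_of_le zero_le_one, intervalIntegral.integral_mul_const,
    integral_pow, Module.finrank_fin_fun]
  push_cast
  ring

theorem vol_naiveRelaxation (hQ : IsCompact Q) (hf : ConvexOn ℝ univ f) (hf₀ : f 0 ≤ 0)
    (hμ : IsConcaveUpperBound f Q μ) (hμint : IntegrableOn μ Q) :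
    vol (naiveRelaxation f Q μ) = (∫ w in Q, μ w) / (d + 2) - dilationIntegral f Q := by
  have := isAddHaarMeasure_volume_prod_prod (E := Fin d → ℝ)
  have hfc : Continuous f := continuousOn_univ.1 (hf.continuousOn isOpen_univ)
  have hJ := continuous_setIntegral_comp_smul hfc hQ
  have hscaled (z : ℝ) : ∫ w in Q, z⁻¹ * f (z • w) = z⁻¹ * ∫ w in Q, f (z • w) :=
    integral_const_mul _ _
  have hconv := convex_naiveRelaxation_inter_pos hf hμ.1
  rw [naiveRelaxation_inter_pos] at hconv
  have hle : ∀ z ∈ Ioc (0 : ℝ) 1, ∀ w ∈ Q, z⁻¹ * f (z • w) ≤ μ w := fun z hz w hw =>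
    (inv_mul_le_iff₀ hz.1).2 ((map_smul_le_of_convexOn hf hf₀ hz.1.le hz.2 w).trans
      (mul_le_mul_of_nonneg_left (hμ.2 w hw) hz.1.le))
  rw [vol_naiveRelaxation_eq_volume_dilationStack,
    volume_real_dilationStack_closedRegionBetween hQ.measurableSet
      (hconv.nullMeasurableSet volume)
      (fun z _ => (by fun_prop : Continuous _).continuousOn.integrableOn_compact hQ) hμint hle
      (by simp only [hscaled]; exact (measurable_inv.mul hJ.measurable).aestronglyMeasurable)]
  calc ∫ z in Ioc (0 : ℝ) 1, z ^ (Module.finrank ℝ (Fin d → ℝ) + 1) *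
        ((∫ w in Q, μ w) - ∫ w in Q, z⁻¹ * f (z • w))
      = ∫ z in Ioc (0 : ℝ) 1, (z ^ (d + 1) * (∫ w in Q, μ w) - z ^ d * ∫ w in Q, f (z • w)) := by
        refine setIntegral_congr_fun measurableSet_Ioc fun z hz => ?_
        have := hz.1.ne'
        simp only [hscaled, Module.finrank_fin_fun]
        field_simp
        ring
    _ = (∫ w in Q, μ w) / (d + 2) - dilationIntegral f Q := by
        rw [← intervalIntegral.integral_of_le zero_le_one, intervalIntegral.integral_sub
          (Continuous.intervalIntegrable (by fun_prop) _ _)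
          (Continuous.intervalIntegrable (by fun_prop) _ _),
          intervalIntegral.integral_mul_const, integral_pow, dilationIntegral]
        push_cast
        ring

theorem cutOff_eq_integral_sub_dilationIntegral (hQ : IsCompact Q) (hf : ConvexOn ℝ univ f)
    (hf₀ : f 0 ≤ 0) (hμ : IsConcaveUpperBound f Q μ) (hμint : IntegrableOn μ Q) :
    cutOff f Q μ = (∫ w in Q, f w) / (d + 2) - dilationIntegral f Q := by
  have hfc : Continuous f := continuousOn_univ.1 (hf.continuousOn isOpen_univ)
  rw [cutOff, vol_naiveRelaxation hQ hf hf₀ hμ hμint, vol_perspRelaxation hQ.measurableSet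
    (hf.subset (subset_univ Q) hμ.1.1) (hfc.continuousOn.integrableOn_compact hQ) hμ hμint]
  ring

theorem integrableOn_concEnv (hQ : IsCompact Q) (hQc : Convex ℝ Q) (hf : ContinuousOn f Q) :
    IntegrableOn (concEnv f Q) Q := by
  obtain ⟨M, hM⟩ := hQ.exists_bound_of_continuousOn hf
  have hconst : IsConcaveUpperBound f Q fun _ => M :=
    ⟨concaveOn_const M hQc, fun x hx => (le_abs_self _).trans (hM x hx)⟩
  have henv := concEnv_isConcaveUpperBound hQc (hQ.bddAbove_image hf)
  have := isFiniteMeasure_restrict.2 (hQ.measure_ne_top (μ := volume))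
  refine Integrable.of_bound (aestronglyMeasurable_of_concaveOn henv.1) M ?_
  refine (ae_restrict_iff' hQ.measurableSet).2 (ae_of_all _ fun x hx => abs_le.2 ⟨?_, ?_⟩)
  · exact (abs_le.1 (hM x hx)).1.trans (henv.2 x hx)
  · exact concEnv_le hconst hx

end Relaxations

section Box

variable {d : ℕ} {c v : Fin d → ℝ} {u : ℝ}

theorem convex_box (v : Fin d → ℝ) (u : ℝ) : Convex ℝ (box v u) :=
  (convex_Icc 0 1).affinity v u

theorem isCompact_box (v : Fin d → ℝ) (u : ℝ) : IsCompact (box v u) :=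
  isCompact_Icc.image (by fun_prop)

theorem setIntegral_box (h : (Fin d → ℝ) → ℝ) (v : Fin d → ℝ) (hu : 0 < u) :
    ∫ x in box v u, h x = u ^ d * ∫ t in Icc (0 : Fin d → ℝ) 1, h (v + u • t) := by
  have hbox : box v u = (v + ·) '' (u • Icc (0 : Fin d → ℝ) 1) := (image_image _ _ _).symm
  rw [hbox, (measurePreserving_add_left volume v).setIntegral_image_emb
      (measurableEmbedding_addLeft v),
    Measure.setIntegral_comp_smul_of_pos volume (fun x => h (v + x)) _ hu,
    Module.finrank_fin_fun, smul_eq_mul, mul_inv_cancel_left₀ (pow_pos hu d).ne']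

theorem integrableOn_comp_box {h : (Fin d → ℝ) → ℝ} (hu : u ≠ 0) (hh : IntegrableOn h (box v u)) :
    IntegrableOn (fun t => h (v + u • t)) (Icc 0 1) := by
  have hinj : Function.Injective fun t : Fin d → ℝ => v + u • t :=
    (add_right_injective v).comp (smul_right_injective _ hu)
  have hbox : MeasurableSet (box v u) := (isCompact_box v u).measurableSet
  have hcomp := (((integrable_indicator_iff hbox).2 hh).comp_add_left v).comp_smul hu
  rw [← integrable_indicator_iff measurableSet_Icc, ← hinj.preimage_image (Icc 0 1)]
  exact hcomp

theorem volume_real_Icc_zero_one {ι : Type*} [Fintype ι] :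
    volume.real (Icc (0 : ι → ℝ) 1) = 1 := by
  simp [Measure.real, Real.volume_Icc_pi]

theorem integral_box_const (v : Fin d → ℝ) (hu : 0 < u) (a : ℝ) :
    ∫ _ in box v u, a = u ^ d * a := by
  rw [setIntegral_box _ _ hu, setIntegral_const, volume_real_Icc_zero_one, one_smul]

/-- The value of `exp (c ⬝ᵥ x)` at the corner `v + u • 1` of `box v u`, which sets the scale of
all volumes as `u → ∞`. -/
noncomputable def boxPeak (c v : Fin d → ℝ) (u : ℝ) : ℝ :=
  Real.exp (c ⬝ᵥ (v + u • 1))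

theorem boxPeak_pos (c v : Fin d → ℝ) (u : ℝ) : 0 < boxPeak c v u :=
  Real.exp_pos _

theorem boxPeak_eq_exp_mul_exp (c v : Fin d → ℝ) (u : ℝ) :
    boxPeak c v u = Real.exp (c ⬝ᵥ v) * Real.exp (u * (c ⬝ᵥ 1)) := by
  rw [boxPeak, dotProduct_add, dotProduct_smul, smul_eq_mul, Real.exp_add]

theorem integral_exp_mul_Icc {a : ℝ} (ha : a ≠ 0) :
    ∫ t in Icc (0 : ℝ) 1, Real.exp (a * t) = (Real.exp a - 1) / a := by
  rw [integral_Icc_eq_integral_Ioc, ← intervalIntegral.integral_of_le zero_le_one,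
    intervalIntegral.integral_comp_mul_left _ ha, integral_exp]
  simp [div_eq_inv_mul]

theorem integral_exp_dotProduct_Icc {ι : Type*} [Fintype ι] {a : ι → ℝ} (ha : ∀ j, a j ≠ 0) :
    ∫ t in Icc (0 : ι → ℝ) 1, Real.exp (a ⬝ᵥ t) = ∏ j, (Real.exp (a j) - 1) / a j := by
  rw [← pi_univ_Icc, volume_pi, Measure.restrict_pi_pi]
  simp only [dotProduct, Real.exp_sum]
  rw [integral_fintype_prod_eq_prod (f := fun j t => Real.exp (a j * t))]
  exact Finset.prod_congr rfl fun j _ => integral_exp_mul_Icc (ha j)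

theorem integral_exp_dotProduct_box (hc : ∀ j, c j ≠ 0) (v : Fin d → ℝ) (hu : 0 < u) :
    ∫ x in box v u, Real.exp (c ⬝ᵥ x) =
      boxPeak c v u * ∏ j, (1 - Real.exp (-(u * c j))) / c j := by
  have hcube : ∏ j, (1 - Real.exp (-(u * c j))) / c j =
      u ^ d * Real.exp (-(u * (c ⬝ᵥ 1))) * ∏ j, (Real.exp ((u • c) j) - 1) / (u • c) j := by
    have hpow : u ^ d = ∏ _j : Fin d, u := by simp
    rw [hpow, dotProduct_one, Finset.mul_sum, ← Finset.sum_neg_distrib, Real.exp_sum,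
      ← Finset.prod_mul_distrib, ← Finset.prod_mul_distrib]
    refine Finset.prod_congr rfl fun j _ => ?_
    have := hc j
    rw [Pi.smul_apply, smul_eq_mul, Real.exp_neg]
    field_simp
  simp only [setIntegral_box _ _ hu, dotProduct_add, dotProduct_smul, Real.exp_add,
    integral_const_mul, ← smul_dotProduct]
  rw [integral_exp_dotProduct_Icc (a := u • c) fun j => mul_ne_zero hu.ne' (hc j), hcube,
    boxPeak_eq_exp_mul_exp, Real.exp_neg]
  field_simp

theorem integral_exp_dotProduct_box_le (hc : ∀ j, 0 < c j) (v : Fin d → ℝ) (hu : 0 < u) :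
    ∫ x in box v u, Real.exp (c ⬝ᵥ x) ≤ boxPeak c v u / ∏ j, c j := by
  rw [integral_exp_dotProduct_box (fun j => (hc j).ne') v hu, div_eq_mul_inv,
    ← Finset.prod_inv_distrib]
  refine mul_le_mul_of_nonneg_left (Finset.prod_le_prod (fun j _ => ?_) fun j _ => ?_)
    (boxPeak_pos c v u).le
  · have hexp : Real.exp (-(u * c j)) ≤ 1 :=
      Real.exp_le_one_iff.2 (neg_nonpos.2 (mul_pos hu (hc j)).le)
    exact div_nonneg (sub_nonneg.2 hexp) (hc j).le
  · rw [inv_eq_one_div]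
    exact div_le_div_of_nonneg_right (sub_le_self 1 (Real.exp_pos _).le) (hc j).le

theorem continuous_expFun (c : Fin d → ℝ) : Continuous (expFun c) := by
  unfold expFun dotProduct
  fun_prop

theorem convexOn_expFun (c : Fin d → ℝ) : ConvexOn ℝ univ (expFun c) :=
  (convexOn_exp.comp_linearMap (dotProductBilin ℝ ℝ c)).sub (concaveOn_const 1 convex_univ)

theorem expFun_zero (c : Fin d → ℝ) : expFun c 0 = 0 := by
  simp [expFun]

theorem neg_one_le_expFun (c x : Fin d → ℝ) : -1 ≤ expFun c x := by
  have := Real.exp_pos (c ⬝ᵥ x)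
  unfold expFun
  linarith

theorem expFun_corner (c v : Fin d → ℝ) (u : ℝ) : expFun c (v + u • 1) = boxPeak c v u - 1 :=
  rfl

theorem isGreatest_expFun_box (hc : ∀ j, 0 ≤ c j) (v : Fin d → ℝ) (hu : 0 ≤ u) :
    IsGreatest (expFun c '' box v u) (expFun c (v + u • 1)) := by
  refine ⟨⟨_, ⟨1, right_mem_Icc.2 zero_le_one, rfl⟩, rfl⟩, ?_⟩
  rintro _ ⟨_, ⟨t, ht, rfl⟩, rfl⟩
  refine sub_le_sub_right (Real.exp_le_exp.2 ?_) 1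
  exact dotProduct_le_dotProduct_of_nonneg_left
    (add_le_add_right (smul_le_smul_of_nonneg_left ht.2 hu) v) hc

theorem maxOn_expFun_box (hc : ∀ j, 0 ≤ c j) (v : Fin d → ℝ) (hu : 0 ≤ u) :
    maxOn (expFun c) (box v u) = expFun c (v + u • 1) :=
  (isGreatest_expFun_box hc v hu).csSup_eq

theorem maxOn_isConcaveUpperBound {f : (Fin d → ℝ) → ℝ} {Q : Set (Fin d → ℝ)} (hQ : Convex ℝ Q)
    (hf : BddAbove (f '' Q)) : IsConcaveUpperBound f Q fun _ => maxOn f Q :=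
  ⟨concaveOn_const _ hQ, fun _ hx => le_csSup hf (mem_image_of_mem f hx)⟩

theorem concEnv_expFun_box_isConcaveUpperBound (c v : Fin d → ℝ) (u : ℝ) :
    IsConcaveUpperBound (expFun c) (box v u) (concEnv (expFun c) (box v u)) :=
  concEnv_isConcaveUpperBound (convex_box v u)
    ((isCompact_box v u).bddAbove_image (continuous_expFun c).continuousOn)

theorem integrableOn_concEnv_expFun_box (c v : Fin d → ℝ) (u : ℝ) :
    IntegrableOn (concEnv (expFun c) (box v u)) (box v u) :=
  integrableOn_concEnv (isCompact_box v u) (convex_box v u) (continuous_expFun c).continuousOn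

theorem maxOn_expFun_box_isConcaveUpperBound (c v : Fin d → ℝ) (u : ℝ) :
    IsConcaveUpperBound (expFun c) (box v u) fun _ => maxOn (expFun c) (box v u) :=
  maxOn_isConcaveUpperBound (convex_box v u)
    ((isCompact_box v u).bddAbove_image (continuous_expFun c).continuousOn)

theorem integrableOn_const_box (v : Fin d → ℝ) (u a : ℝ) :
    IntegrableOn (fun _ => a) (box v u) :=
  integrableOn_const (isCompact_box v u).measure_ne_top

theorem vol_naiveRelaxation_expFun_box {μ : (Fin d → ℝ) → ℝ}
    (hμ : IsConcaveUpperBound (expFun c) (box v u) μ) (hμint : IntegrableOn μ (box v u)) :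
    vol (naiveRelaxation (expFun c) (box v u) μ) =
      (∫ x in box v u, μ x) / (d + 2) - dilationIntegral (expFun c) (box v u) :=
  vol_naiveRelaxation (isCompact_box v u) (convexOn_expFun c) (expFun_zero c).le hμ hμint

theorem cutOff_expFun_box {μ : (Fin d → ℝ) → ℝ}
    (hμ : IsConcaveUpperBound (expFun c) (box v u) μ) (hμint : IntegrableOn μ (box v u)) :
    cutOff (expFun c) (box v u) μ =
      (∫ x in box v u, expFun c x) / (d + 2) - dilationIntegral (expFun c) (box v u) :=
  cutOff_eq_integral_sub_dilationIntegral (isCompact_box v u) (convexOn_expFun c)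
    (expFun_zero c).le hμ hμint

theorem neg_pow_le_dilationIntegral_expFun_box (c v : Fin d → ℝ) (hu : 0 < u) :
    -u ^ d ≤ dilationIntegral (expFun c) (box v u) := by
  have hcont := continuous_setIntegral_comp_smul (continuous_expFun c) (isCompact_box v u)
  have hslice (z : ℝ) : -u ^ d ≤ ∫ x in box v u, expFun c (z • x) := by
    have hsmul : Continuous fun x : Fin d → ℝ => expFun c (z • x) :=
      (continuous_expFun c).comp (continuous_const_smul z)
    rw [← mul_neg_one, ← integral_box_const v hu (-1)]
    exact setIntegral_mono (integrableOn_const_box v u (-1))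
      (hsmul.continuousOn.integrableOn_compact (isCompact_box v u))
      fun x => neg_one_le_expFun c (z • x)
  have hpow : ∀ z ∈ Icc (0 : ℝ) 1, -u ^ d ≤ z ^ d * ∫ x in box v u, expFun c (z • x) := by
    intro z hz
    calc -u ^ d ≤ z ^ d * -u ^ d := by
          rw [mul_neg, neg_le_neg_iff]
          exact mul_le_of_le_one_left (pow_nonneg hu.le d) (pow_le_one₀ hz.1 hz.2)
      _ ≤ z ^ d * ∫ x in box v u, expFun c (z • x) :=
          mul_le_mul_of_nonneg_left (hslice z) (pow_nonneg hz.1 d)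
  calc -u ^ d = ∫ _ in (0 : ℝ)..1, -u ^ d := by simp
    _ ≤ dilationIntegral (expFun c) (box v u) :=
        intervalIntegral.integral_mono_on zero_le_one intervalIntegrable_const
          (((continuous_pow d).mul hcont).intervalIntegrable 0 1) hpow

theorem pow_mul_setIntegral_expFun_smul_box_le (hc : ∀ j, 0 < c j) (v : Fin d → ℝ) (hu : 0 < u)
    {z : ℝ} (hz : 0 < z) :
    z ^ d * ∫ x in box v u, expFun c (z • x) ≤
      Real.exp (c ⬝ᵥ (v + u • 1) * z) / ∏ j, c j := by
  have hpeak : boxPeak (z • c) v u = Real.exp (c ⬝ᵥ (v + u • 1) * z) := by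
    rw [boxPeak, smul_dotProduct, smul_eq_mul, mul_comm]
  have hprod : ∏ j, (z • c) j = z ^ d * ∏ j, c j := by
    simp [Finset.prod_mul_distrib]
  have hsmul : Continuous fun x : Fin d → ℝ => expFun c (z • x) :=
    (continuous_expFun c).comp (continuous_const_smul z)
  have hexp : Continuous fun x : Fin d → ℝ => Real.exp ((z • c) ⬝ᵥ x) := by
    unfold dotProduct
    fun_prop
  calc z ^ d * ∫ x in box v u, expFun c (z • x)
      ≤ z ^ d * ∫ x in box v u, Real.exp ((z • c) ⬝ᵥ x) := by
        refine mul_le_mul_of_nonneg_left (setIntegral_mono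
          (hsmul.continuousOn.integrableOn_compact (isCompact_box v u))
          (hexp.continuousOn.integrableOn_compact (isCompact_box v u)) fun x => ?_)
          (pow_nonneg hz.le d)
        rw [expFun, dotProduct_smul, ← smul_dotProduct]
        exact sub_le_self _ zero_le_one
    _ ≤ z ^ d * (boxPeak (z • c) v u / ∏ j, (z • c) j) :=
        mul_le_mul_of_nonneg_left
          (integral_exp_dotProduct_box_le (fun j => mul_pos hz (hc j)) v hu) (pow_nonneg hz.le d)
    _ = Real.exp (c ⬝ᵥ (v + u • 1) * z) / ∏ j, c j := by
        rw [hpeak, hprod, ← mul_div_assoc, mul_div_mul_left _ _ (pow_pos hz d).ne']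

theorem dilationIntegral_expFun_box_le (hc : ∀ j, 0 < c j) (hu : 0 < u)
    (hk : 0 < c ⬝ᵥ (v + u • 1)) :
    dilationIntegral (expFun c) (box v u) ≤
      boxPeak c v u / ((c ⬝ᵥ (v + u • 1)) * ∏ j, c j) := by
  set k := c ⬝ᵥ (v + u • 1)
  have hprod : 0 < ∏ j, c j := Finset.prod_pos fun j _ => hc j
  have hcont := continuous_setIntegral_comp_smul (continuous_expFun c) (isCompact_box v u)
  calc dilationIntegral (expFun c) (box v u)
      ≤ ∫ z in (0 : ℝ)..1, Real.exp (k * z) / ∏ j, c j :=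
        intervalIntegral.integral_mono_on_of_le_Ioo zero_le_one
          (((continuous_pow d).mul hcont).intervalIntegrable 0 1)
          (Continuous.intervalIntegrable (by fun_prop) 0 1)
          fun z hz => pow_mul_setIntegral_expFun_smul_box_le hc v hu hz.1
    _ = (Real.exp k - 1) / k / ∏ j, c j := by
        rw [intervalIntegral.integral_div, intervalIntegral.integral_of_le zero_le_one,
          ← integral_Icc_eq_integral_Ioc, integral_exp_mul_Icc hk.ne']
    _ ≤ boxPeak c v u / (k * ∏ j, c j) := by
        rw [div_div]
        exact div_le_div_of_nonneg_right (sub_le_self _ zero_le_one) (by positivity)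

theorem expFun_le_of_mem_Icc (hc : ∀ j, 0 ≤ c j) (v : Fin d → ℝ) (hu : 0 ≤ u) (j : Fin d)
    {t : Fin d → ℝ} (ht : t ∈ Icc 0 1) :
    expFun c (v + u • t) ≤ boxPeak c v u * (t j + Real.exp (-(u * c j))) := by
  have htj : 0 ≤ t j ∧ t j ≤ 1 := ⟨ht.1 j, ht.2 j⟩
  -- Raise the other coordinates to `1`, then interpolate between the facets `t j = 0`, `t j = 1`.
  have hdot : c ⬝ᵥ t ≤ c ⬝ᵥ 1 - c j * (1 - t j) := by
    have hterm := Finset.single_le_sum (f := fun i => c i * (1 - t i))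
      (fun i _ => mul_nonneg (hc i) (sub_nonneg.2 (ht.2 i))) (Finset.mem_univ j)
    have hsum : ∑ i, c i * (1 - t i) = c ⬝ᵥ 1 - c ⬝ᵥ t := by
      simp [dotProduct, mul_sub, Finset.sum_sub_distrib]
    linarith
  have hconv : Real.exp ((1 - t j) * -(u * c j)) ≤ (1 - t j) * Real.exp (-(u * c j)) + t j := by
    have := convexOn_exp.2 (mem_univ (-(u * c j))) (mem_univ 0) (sub_nonneg.2 htj.2) htj.1
      (sub_add_cancel 1 (t j))
    simpa using this
  calc expFun c (v + u • t) ≤ Real.exp (c ⬝ᵥ (v + u • t)) := sub_le_self _ zero_le_one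
    _ ≤ Real.exp (c ⬝ᵥ (v + u • 1) + (1 - t j) * -(u * c j)) := by
        rw [Real.exp_le_exp, dotProduct_add, dotProduct_add, dotProduct_smul, dotProduct_smul,
          smul_eq_mul, smul_eq_mul]
        linarith [mul_le_mul_of_nonneg_left hdot hu]
    _ ≤ boxPeak c v u * (t j + Real.exp (-(u * c j))) := by
        rw [Real.exp_add]
        refine mul_le_mul_of_nonneg_left (hconv.trans ?_) (boxPeak_pos c v u).le
        linarith [mul_nonneg htj.1 (Real.exp_pos (-(u * c j))).le]

theorem concEnv_expFun_box_le (hc : ∀ j, 0 ≤ c j) (v : Fin d → ℝ) (hu : 0 < u) (j : Fin d)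
    {t : Fin d → ℝ} (ht : t ∈ Icc 0 1) :
    concEnv (expFun c) (box v u) (v + u • t) ≤
      boxPeak c v u * (t j + Real.exp (-(u * c j))) := by
  have hcoord (s : Fin d → ℝ) : ((v + u • s) j - v j) / u = s j := by
    simp [hu.ne']
  have hbound : IsConcaveUpperBound (expFun c) (box v u) fun x =>
      boxPeak c v u * ((x j - v j) / u + Real.exp (-(u * c j))) := by
    refine ⟨⟨convex_box v u, fun x _ y _ a b _ _ hab => le_of_eq ?_⟩, ?_⟩
    · simp only [smul_eq_mul, Pi.add_apply, Pi.smul_apply]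
      linear_combination
        boxPeak c v u * (Real.exp (-(u * c j)) - v j / u) * hab
    · rintro _ ⟨s, hs, rfl⟩
      simpa only [hcoord] using expFun_le_of_mem_Icc hc v hu.le j hs
  have henv := concEnv_le hbound (mem_image_of_mem (fun s => v + u • s) ht)
  rwa [hcoord] at henv

end Box

section MinCoordinate

variable {ι : Type*} [Nonempty ι]

theorem iInf_mem_Icc [Finite ι] {t : ι → ℝ} (ht : t ∈ Icc 0 1) : ⨅ j, t j ∈ Icc (0 : ℝ) 1 := by
  obtain ⟨j, hj⟩ := exists_eq_ciInf_of_finite (f := t)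
  rw [← hj]
  exact ⟨ht.1 j, ht.2 j⟩

theorem exists_eq_iInf_smul_one_add [Finite ι] {t : ι → ℝ} (ht : t ∈ Icc 0 1) :
    ∃ s ∈ Icc (0 : ι → ℝ) 1, t = (⨅ j, t j) • (1 : ι → ℝ) + (1 - ⨅ j, t j) • s := by
  set m := ⨅ j, t j
  have hmt (j : ι) : m ≤ t j := ciInf_le (finite_range t).bddBelow j
  obtain ⟨-, hm₁⟩ : m ∈ Icc (0 : ℝ) 1 := iInf_mem_Icc ht
  rcases hm₁.eq_or_lt with hm | hm
  · refine ⟨t, ht, funext fun j => ?_⟩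
    simp only [hm, one_smul, sub_self, zero_smul, add_zero]
    exact (ht.2 j).antisymm (hm.ge.trans (hmt j))
  · refine ⟨(1 - m)⁻¹ • (t - m • 1), ⟨fun j => ?_, fun j => ?_⟩, ?_⟩
    · simpa using mul_nonneg (inv_nonneg.2 (sub_nonneg.2 hm₁)) (sub_nonneg.2 (hmt j))
    · simpa [inv_mul_le_iff₀ (sub_pos.2 hm)] using ht.2 j
    · rw [smul_inv_smul₀ (sub_pos.2 hm).ne', add_sub_cancel]

variable [Fintype ι]

theorem integrableOn_iInf_Icc :
    IntegrableOn (fun t : ι → ℝ => ⨅ j, t j) (Icc 0 1) := by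
  have : IsFiniteMeasure (volume.restrict (Icc (0 : ι → ℝ) 1)) :=
    isFiniteMeasure_restrict.2 isCompact_Icc.measure_ne_top
  refine Integrable.of_bound (Measurable.iInf measurable_pi_apply).aestronglyMeasurable 1 ?_
  refine (ae_restrict_iff' measurableSet_Icc).2 (ae_of_all _ fun t ht => ?_)
  rw [Real.norm_of_nonneg (iInf_mem_Icc ht).1]
  exact (iInf_mem_Icc ht).2

theorem integral_iInf_Icc :
    ∫ t in Icc (0 : ι → ℝ) 1, ⨅ j, t j = 1 / (Fintype.card ι + 1) := by
  have hlevel (s : ℝ) (hs : s ∈ Ioc (0 : ℝ) 1) :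
      (volume.restrict (Icc (0 : ι → ℝ) 1)).real {t | s ≤ ⨅ j, t j} =
        (1 - s) ^ Fintype.card ι := by
    have hset : {t | s ≤ ⨅ j, t j} ∩ Icc (0 : ι → ℝ) 1 = Icc (fun _ => s) (1 : ι → ℝ) := by
      ext t
      simp only [mem_inter_iff, mem_ofPred_eq, le_ciInf_iff (finite_range t).bddBelow]
      exact ⟨fun h => ⟨h.1, h.2.2⟩, fun h => ⟨h.1, fun j => hs.1.le.trans (h.1 j), h.2⟩⟩
    rw [measureReal_restrict_apply' measurableSet_Icc, hset, Measure.real, Real.volume_Icc_pi]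
    simp [hs.2]
  have hbounds : ∀ᵐ t ∂volume.restrict (Icc (0 : ι → ℝ) 1), ⨅ j, t j ∈ Icc (0 : ℝ) 1 :=
    (ae_restrict_iff' measurableSet_Icc).2 (ae_of_all _ fun _ => iInf_mem_Icc)
  rw [integrableOn_iInf_Icc.integral_eq_integral_Ioc_meas_le (hbounds.mono fun _ h => h.1)
    (hbounds.mono fun _ h => h.2), setIntegral_congr_fun measurableSet_Ioc hlevel,
    ← intervalIntegral.integral_of_le zero_le_one,
    intervalIntegral.integral_comp_sub_left (fun x => x ^ Fintype.card ι), integral_pow]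
  simp

end MinCoordinate

section Asymptotics

variable {d : ℕ} [NeZero d] {c v : Fin d → ℝ} {u : ℝ}

theorem boxPeak_mul_iInf_sub_one_le {g : (Fin d → ℝ) → ℝ}
    (hg : IsConcaveUpperBound (expFun c) (box v u) g) {t : Fin d → ℝ} (ht : t ∈ Icc 0 1) :
    boxPeak c v u * (⨅ j, t j) - 1 ≤ g (v + u • t) := by
  obtain ⟨s, hs, hts⟩ := exists_eq_iInf_smul_one_add ht
  obtain ⟨hm₀, hm₁⟩ := iInf_mem_Icc ht
  set m := ⨅ j, t j
  have hcorner : v + u • 1 ∈ box v u := mem_image_of_mem _ (right_mem_Icc.2 zero_le_one)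
  have hmem : v + u • s ∈ box v u := mem_image_of_mem _ hs
  have hpoint : v + u • t = m • (v + u • 1) + (1 - m) • (v + u • s) := by
    rw [hts]
    module
  calc boxPeak c v u * m - 1 = m * (boxPeak c v u - 1) + (1 - m) * -1 := by ring
    _ ≤ m * g (v + u • 1) + (1 - m) * g (v + u • s) :=
        add_le_add (mul_le_mul_of_nonneg_left (hg.2 _ hcorner) hm₀)
          (mul_le_mul_of_nonneg_left ((neg_one_le_expFun c _).trans (hg.2 _ hmem))
            (sub_nonneg.2 hm₁))
    _ ≤ g (v + u • t) := by
        rw [hpoint]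
        exact hg.1.2 hcorner hmem hm₀ (sub_nonneg.2 hm₁) (add_sub_cancel m 1)

theorem concEnv_expFun_box_le_iInf (hc : ∀ j, 0 ≤ c j) (v : Fin d → ℝ) (hu : 0 < u)
    {t : Fin d → ℝ} (ht : t ∈ Icc 0 1) :
    concEnv (expFun c) (box v u) (v + u • t) ≤
      boxPeak c v u * ((⨅ j, t j) + ∑ j, Real.exp (-(u * c j))) := by
  obtain ⟨j, hj⟩ := exists_eq_ciInf_of_finite (f := t)
  refine (concEnv_expFun_box_le hc v hu j ht).trans
    (mul_le_mul_of_nonneg_left (add_le_add hj.le ?_) (boxPeak_pos c v u).le)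
  exact Finset.single_le_sum (f := fun i => Real.exp (-(u * c i)))
    (fun i _ => (Real.exp_pos _).le) (Finset.mem_univ j)

theorem boxPeak_mul_le_setIntegral_of_isConcaveUpperBound {g : (Fin d → ℝ) → ℝ} (hu : 0 < u)
    (hg : IsConcaveUpperBound (expFun c) (box v u) g) (hint : IntegrableOn g (box v u)) :
    u ^ d * (boxPeak c v u * (1 / (d + 1)) - 1) ≤ ∫ x in box v u, g x := by
  have hconst : IntegrableOn (fun _ : Fin d → ℝ => (1 : ℝ)) (Icc 0 1) :=
    integrableOn_const isCompact_Icc.measure_ne_top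
  have hmin := integrableOn_iInf_Icc (ι := Fin d).const_mul (boxPeak c v u)
  rw [setIntegral_box _ _ hu]
  refine mul_le_mul_of_nonneg_left ?_ (pow_nonneg hu.le d)
  calc boxPeak c v u * (1 / (d + 1)) - 1
      = ∫ t in Icc (0 : Fin d → ℝ) 1, (boxPeak c v u * (⨅ j, t j) - 1) := by
        rw [integral_sub hmin hconst, integral_const_mul, integral_iInf_Icc, setIntegral_const,
          volume_real_Icc_zero_one, one_smul, Fintype.card_fin]
    _ ≤ ∫ t in Icc (0 : Fin d → ℝ) 1, g (v + u • t) :=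
        setIntegral_mono_on (hmin.sub hconst) (integrableOn_comp_box hu.ne' hint)
          measurableSet_Icc fun _ ht => boxPeak_mul_iInf_sub_one_le hg ht

theorem setIntegral_concEnv_expFun_box_le (hc : ∀ j, 0 ≤ c j) (v : Fin d → ℝ) (hu : 0 < u) :
    ∫ x in box v u, concEnv (expFun c) (box v u) x ≤
      u ^ d * (boxPeak c v u * (1 / (d + 1) + ∑ j, Real.exp (-(u * c j)))) := by
  have hconst : IntegrableOn (fun _ : Fin d → ℝ => ∑ j, Real.exp (-(u * c j))) (Icc 0 1) :=
    integrableOn_const isCompact_Icc.measure_ne_top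
  rw [setIntegral_box _ _ hu]
  refine mul_le_mul_of_nonneg_left ?_ (pow_nonneg hu.le d)
  calc ∫ t in Icc (0 : Fin d → ℝ) 1, concEnv (expFun c) (box v u) (v + u • t)
      ≤ ∫ t in Icc (0 : Fin d → ℝ) 1,
          boxPeak c v u * ((⨅ j, t j) + ∑ j, Real.exp (-(u * c j))) :=
        setIntegral_mono_on (integrableOn_comp_box hu.ne' (integrableOn_concEnv_expFun_box c v u))
          ((integrableOn_iInf_Icc.add hconst).const_mul _) measurableSet_Icc
          fun _ ht => concEnv_expFun_box_le_iInf hc v hu ht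
    _ = boxPeak c v u * (1 / (d + 1) + ∑ j, Real.exp (-(u * c j))) := by
        rw [integral_const_mul, integral_add integrableOn_iInf_Icc hconst, integral_iInf_Icc,
          setIntegral_const, volume_real_Icc_zero_one, one_smul, Fintype.card_fin]

theorem tendsto_dotProduct_corner (hc : ∀ j, 0 < c j) (v : Fin d → ℝ) :
    Tendsto (fun u : ℝ => c ⬝ᵥ (v + u • 1)) atTop atTop := by
  simp only [dotProduct_add, dotProduct_smul, smul_eq_mul, dotProduct_one]
  exact tendsto_atTop_add_const_left _ _ (tendsto_id.atTop_mul_const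
    (Finset.sum_pos (fun j _ => hc j) Finset.univ_nonempty))

theorem tendsto_pow_div_boxPeak (hc : ∀ j, 0 < c j) (v : Fin d → ℝ) (n : ℕ) :
    Tendsto (fun u => u ^ n / boxPeak c v u) atTop (𝓝 0) := by
  have hsum : 0 < ∑ j, c j := Finset.sum_pos (fun j _ => hc j) Finset.univ_nonempty
  have h := (tendsto_rpow_mul_exp_neg_mul_atTop_nhds_zero n _ hsum).div_const (Real.exp (c ⬝ᵥ v))
  rw [zero_div] at h
  refine h.congr fun u => ?_
  rw [boxPeak_eq_exp_mul_exp, dotProduct_one, Real.rpow_natCast, mul_comm u, neg_mul,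
    Real.exp_neg]
  field_simp

theorem tendsto_exp_neg_mul {a : ℝ} (ha : 0 < a) :
    Tendsto (fun u : ℝ => Real.exp (-(u * a))) atTop (𝓝 0) :=
  Real.tendsto_exp_neg_atTop_nhds_zero.comp (tendsto_id.atTop_mul_const ha)

theorem tendsto_setIntegral_expFun_box_div_boxPeak (hc : ∀ j, 0 < c j) (v : Fin d → ℝ) :
    Tendsto (fun u => (∫ x in box v u, expFun c x) / boxPeak c v u) atTop
      (𝓝 (∏ j, c j)⁻¹) := by
  have hprod : Tendsto (fun u : ℝ => ∏ j, (1 - Real.exp (-(u * c j))) / c j) atTop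
      (𝓝 (∏ j, (1 - 0) / c j)) :=
    tendsto_finsetProd _ fun j _ => ((tendsto_exp_neg_mul (hc j)).const_sub 1).div_const _
  have h := hprod.sub (tendsto_pow_div_boxPeak hc v d)
  simp only [sub_zero, one_div, Finset.prod_inv_distrib] at h
  refine h.congr' ?_
  filter_upwards [eventually_gt_atTop 0] with u hu
  have hexp : Continuous fun x : Fin d → ℝ => Real.exp (c ⬝ᵥ x) := by
    unfold dotProduct
    fun_prop
  have hint : ∫ x in box v u, expFun c x =
      boxPeak c v u * (∏ j, (1 - Real.exp (-(u * c j))) / c j) - u ^ d := by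
    rw [← integral_exp_dotProduct_box (fun j => (hc j).ne') v hu, ← mul_one (u ^ d),
      ← integral_box_const v hu 1]
    exact integral_sub (hexp.continuousOn.integrableOn_compact (isCompact_box v u))
      (integrableOn_const_box v u 1)
  rw [hint, sub_div, mul_div_cancel_left₀ _ (boxPeak_pos c v u).ne']

theorem tendsto_dilationIntegral_div_boxPeak (hc : ∀ j, 0 < c j) (v : Fin d → ℝ) :
    Tendsto (fun u => dilationIntegral (expFun c) (box v u) / boxPeak c v u) atTop (𝓝 0) := by
  have hprod : 0 < ∏ j, c j := Finset.prod_pos fun j _ => hc j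
  have hlow := (tendsto_pow_div_boxPeak hc v d).neg
  rw [neg_zero] at hlow
  refine tendsto_of_tendsto_of_tendsto_of_le_of_le' hlow
    ((tendsto_dotProduct_corner hc v).atTop_mul_const hprod).inv_tendsto_atTop ?_ ?_
  · filter_upwards [eventually_gt_atTop 0] with u hu
    rw [← neg_div]
    exact div_le_div_of_nonneg_right (neg_pow_le_dilationIntegral_expFun_box c v hu)
      (boxPeak_pos c v u).le
  · filter_upwards [eventually_gt_atTop 0, (tendsto_dotProduct_corner hc v).eventually_gt_atTop 0]
      with u hu hk
    rw [div_le_iff₀ (boxPeak_pos c v u), Pi.inv_apply, inv_mul_eq_div]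
    exact dilationIntegral_expFun_box_le hc hu hk

theorem tendsto_setIntegral_maxOn_expFun_box (hc : ∀ j, 0 < c j) (v : Fin d → ℝ) :
    Tendsto (fun u => (∫ _ in box v u, maxOn (expFun c) (box v u)) / (boxPeak c v u * u ^ d))
      atTop (𝓝 1) := by
  have h := (tendsto_pow_div_boxPeak hc v 0).const_sub 1
  rw [sub_zero] at h
  refine h.congr' ?_
  filter_upwards [eventually_gt_atTop 0] with u hu
  have := (boxPeak_pos c v u).ne'
  rw [integral_box_const v hu, maxOn_expFun_box (fun j => (hc j).le) v hu.le, expFun_corner]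
  field_simp

theorem tendsto_setIntegral_concEnv_expFun_box (hc : ∀ j, 0 < c j) (v : Fin d → ℝ) :
    Tendsto (fun u => (∫ x in box v u, concEnv (expFun c) (box v u) x) / (boxPeak c v u * u ^ d))
      atTop (𝓝 (1 / (d + 1))) := by
  have hlow := (tendsto_pow_div_boxPeak hc v 0).const_sub (1 / ((d : ℝ) + 1))
  have hup := (tendsto_finsetSum Finset.univ fun j _ =>
    tendsto_exp_neg_mul (hc j)).const_add (1 / ((d : ℝ) + 1))
  rw [sub_zero] at hlow
  rw [Finset.sum_const_zero, add_zero] at hup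
  refine tendsto_of_tendsto_of_tendsto_of_le_of_le' hlow hup ?_ ?_ <;>
    filter_upwards [eventually_gt_atTop 0] with u hu
  all_goals have hpeak := boxPeak_pos c v u
  · rw [le_div_iff₀ (by positivity)]
    refine le_trans (le_of_eq ?_) (boxPeak_mul_le_setIntegral_of_isConcaveUpperBound hu
      (concEnv_expFun_box_isConcaveUpperBound c v u) (integrableOn_concEnv_expFun_box c v u))
    field_simp
  · rw [div_le_iff₀ (by positivity)]
    refine (setIntegral_concEnv_expFun_box_le (fun j => (hc j).le) v hu).trans (le_of_eq ?_)
    ring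

theorem tendsto_inv_pow_atTop : Tendsto (fun u : ℝ => (u ^ d)⁻¹) atTop (𝓝 0) :=
  (tendsto_pow_atTop (NeZero.ne d)).inv_tendsto_atTop

theorem tendsto_zero_of_tendsto_pow_mul {r : ℝ → ℝ} {a : ℝ}
    (h : Tendsto (fun u => u ^ d * r u) atTop (𝓝 a)) : Tendsto r atTop (𝓝 0) := by
  have hr := h.mul (tendsto_inv_pow_atTop (d := d))
  rw [mul_zero] at hr
  refine hr.congr' ?_
  filter_upwards [eventually_gt_atTop 0] with u hu
  field_simp

theorem tendsto_pow_mul_cutOffRatio {μ : ℝ → (Fin d → ℝ) → ℝ} {ρ : ℝ} (hc : ∀ j, 0 < c j)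
    (hμ : ∀ u > 0, IsConcaveUpperBound (expFun c) (box v u) (μ u))
    (hint : ∀ u > 0, IntegrableOn (μ u) (box v u)) (hρ : ρ ≠ 0)
    (hlim : Tendsto (fun u => (∫ x in box v u, μ u x) / (boxPeak c v u * u ^ d)) atTop (𝓝 ρ)) :
    Tendsto (fun u => u ^ d * cutOffRatio (expFun c) (box v u) (μ u)) atTop
      (𝓝 (1 / (ρ * ∏ j, c j))) := by
  have hd : (d : ℝ) + 2 ≠ 0 := by positivity
  have hdil := tendsto_dilationIntegral_div_boxPeak hc v
  have hcut := ((tendsto_setIntegral_expFun_box_div_boxPeak hc v).div_const (d + 2)).sub hdil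
  have hvol := (hlim.div_const (d + 2)).sub (hdil.mul (tendsto_inv_pow_atTop (d := d)))
  rw [sub_zero] at hcut
  rw [mul_zero, sub_zero] at hvol
  have hratio := hcut.div hvol (div_ne_zero hρ hd)
  rw [div_div_div_cancel_right₀ hd, inv_eq_one_div, div_div, mul_comm] at hratio
  refine hratio.congr' ?_
  filter_upwards [eventually_gt_atTop 0] with u hu
  have hpeak := (boxPeak_pos c v u).ne'
  rw [cutOffRatio, cutOff_expFun_box (hμ u hu) (hint u hu),
    vol_naiveRelaxation_expFun_box (hμ u hu) (hint u hu), Pi.div_apply]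
  field_simp

end Asymptotics

end BoxRelax

open BoxRelax Filter Topology in
theorem mainTheorem1_general (d : ℕ) (hd : 1 ≤ d) (c v₀ : Fin d → ℝ) (hc : ∀ j, 0 < c j) :
    (∀ u : ℝ, 0 < u →
      IsGreatest (expFun c '' box v₀ u) (maxOn (expFun c) (box v₀ u)) ∧
      maxOn (expFun c) (box v₀ u) = expFun c (v₀ + u • (1 : Fin d → ℝ)) ∧
      maxOn (expFun c) (box v₀ u) =
        Real.exp (c ⬝ᵥ v₀) * Real.exp (u * (c ⬝ᵥ (1 : Fin d → ℝ))) - 1) ∧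
    (∀ u : ℝ, 0 < u →
      cutOff (expFun c) (box v₀ u) (concEnv (expFun c) (box v₀ u)) =
      cutOff (expFun c) (box v₀ u) (fun _ => maxOn (expFun c) (box v₀ u))) ∧
    Tendsto
      (fun u : ℝ => u ^ d *
        cutOffRatio (expFun c) (box v₀ u) (concEnv (expFun c) (box v₀ u)))
      atTop (𝓝 (((d : ℝ) + 1) / ∏ j, c j)) ∧
    Tendsto
      (fun u : ℝ => u ^ d * (((d : ℝ) + 1) *
        cutOffRatio (expFun c) (box v₀ u) (fun _ => maxOn (expFun c) (box v₀ u))))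
      atTop (𝓝 (((d : ℝ) + 1) / ∏ j, c j)) ∧
    Tendsto
      (fun u : ℝ => cutOffRatio (expFun c) (box v₀ u) (concEnv (expFun c) (box v₀ u)))
      atTop (𝓝 0) ∧
    Tendsto
      (fun u : ℝ => cutOffRatio (expFun c) (box v₀ u) (fun _ => maxOn (expFun c) (box v₀ u)))
      atTop (𝓝 0) := by
  have : NeZero d := ⟨Nat.one_le_iff_ne_zero.1 hd⟩
  have hconc := tendsto_pow_mul_cutOffRatio hc
    (fun u _ => concEnv_expFun_box_isConcaveUpperBound c v₀ u)
    (fun u _ => integrableOn_concEnv_expFun_box c v₀ u) (by positivity)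
    (tendsto_setIntegral_concEnv_expFun_box hc v₀)
  have hmax := tendsto_pow_mul_cutOffRatio hc
    (fun u _ => maxOn_expFun_box_isConcaveUpperBound c v₀ u)
    (fun u _ => integrableOn_const_box v₀ u _) one_ne_zero
    (tendsto_setIntegral_maxOn_expFun_box hc v₀)
  refine ⟨fun u hu => ?_, fun u _ => ?_, ?_, ?_, tendsto_zero_of_tendsto_pow_mul hconc,
    tendsto_zero_of_tendsto_pow_mul hmax⟩
  · rw [maxOn_expFun_box (fun j => (hc j).le) v₀ hu.le, ← boxPeak_eq_exp_mul_exp]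
    exact ⟨isGreatest_expFun_box (fun j => (hc j).le) v₀ hu.le, rfl, rfl⟩
  · rw [cutOff_expFun_box (concEnv_expFun_box_isConcaveUpperBound c v₀ u)
        (integrableOn_concEnv_expFun_box c v₀ u),
      cutOff_expFun_box (maxOn_expFun_box_isConcaveUpperBound c v₀ u)
        (integrableOn_const_box v₀ u _)]
  · rwa [← div_div, one_div_one_div] at hconc
  · simpa only [mul_left_comm, one_mul, mul_one_div] using hmax.const_mul ((d : ℝ) + 1)

theorem mainTheorem1 (d : ℕ) (hd : 1 ≤ d) (c v₀ : Fin d → ℝ)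
    (hc : ∀ j, 0 < c j) (hv₀ : ∀ j, 0 < v₀ j) :
    -- the constant bound `F` is a maximum, and its explicit value
    (∀ u : ℝ, 0 < u →
      IsGreatest (BoxRelax.expFun c '' BoxRelax.box v₀ u)
        (BoxRelax.maxOn (BoxRelax.expFun c) (BoxRelax.box v₀ u)) ∧
      BoxRelax.maxOn (BoxRelax.expFun c) (BoxRelax.box v₀ u) =
        BoxRelax.expFun c (v₀ + u • (1 : Fin d → ℝ)) ∧
      BoxRelax.maxOn (BoxRelax.expFun c) (BoxRelax.box v₀ u) =
        Real.exp (c ⬝ᵥ v₀) * Real.exp (u * (c ⬝ᵥ (1 : Fin d → ℝ))) - 1) ∧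
    -- the cut-off amount is the same for both upper bounds
    (∀ u : ℝ, 0 < u →
      BoxRelax.cutOff (BoxRelax.expFun c) (BoxRelax.box v₀ u)
        (BoxRelax.concEnv (BoxRelax.expFun c) (BoxRelax.box v₀ u)) =
      BoxRelax.cutOff (BoxRelax.expFun c) (BoxRelax.box v₀ u)
        (fun _ => BoxRelax.maxOn (BoxRelax.expFun c) (BoxRelax.box v₀ u))) ∧
    -- the limit for the concave envelope
    Filter.Tendsto
      (fun u : ℝ => u ^ d * BoxRelax.cutOffRatio (BoxRelax.expFun c) (BoxRelax.box v₀ u)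
        (BoxRelax.concEnv (BoxRelax.expFun c) (BoxRelax.box v₀ u)))
      Filter.atTop (nhds (((d : ℝ) + 1) / ∏ j, c j)) ∧
    -- the limit for the constant upper bound
    Filter.Tendsto
      (fun u : ℝ => u ^ d * (((d : ℝ) + 1) *
        BoxRelax.cutOffRatio (BoxRelax.expFun c) (BoxRelax.box v₀ u)
          (fun _ => BoxRelax.maxOn (BoxRelax.expFun c) (BoxRelax.box v₀ u))))
      Filter.atTop (nhds (((d : ℝ) + 1) / ∏ j, c j)) ∧
    -- in particular both cut-off ratios tend to zero
    Filter.Tendsto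
      (fun u : ℝ => BoxRelax.cutOffRatio (BoxRelax.expFun c) (BoxRelax.box v₀ u)
        (BoxRelax.concEnv (BoxRelax.expFun c) (BoxRelax.box v₀ u)))
      Filter.atTop (nhds 0) ∧
    Filter.Tendsto
      (fun u : ℝ => BoxRelax.cutOffRatio (BoxRelax.expFun c) (BoxRelax.box v₀ u)
        (fun _ => BoxRelax.maxOn (BoxRelax.expFun c) (BoxRelax.box v₀ u)))
      Filter.atTop (nhds 0) :=
  mainTheorem1_general d hd c v₀ hc
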